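/- All graphs are finite, simple and undirected. A *tree-decomposition* of a graph $G$ is a family $(B_x : x\in V(T))$ of subsets of $V(G)$ (bags) indexed by the vertices of a tree $T$, such that for every edge $uv$ of $G$ some bag contains both $u$ and $v$, and for every vertex $v$ of $G$ the set $\{x\in V(T): v\in B_x\}$ induces a non-empty connected subtree of $T$. Its *width* is $\max_x |B_x|-1$, and the *treewidth* of $G$ is the minimum width of a tree-decomposition of $G$. A *monochromatic component* of a (not necessarily proper) vertex-colouring of $G$ is a connected component of the subgraph induced by the vertices of one colour. A colouring has *defect* $d$ if every monochromatic component has maximum degree at most $d$, and *clustering* $m$ if every monochromatic component has at most $m$ vertices. For a class $\mathcal G$ of graphs, the *defective chromatic number* $\chi_\Delta(\mathcal G)$ (respectively the *clustered chromatic number* $\chi_\star(\mathcal G)$) is the minimum integer $c$ for which there is an integer $d$ such that every graph in $\mathcal G$ has a colouring with at most $c$ colours and defect $d$ (respectively clustering $d$). The *chromatic number* of the class is $\chi(\mathcal G)=\max\{\chi(G):G\in\mathcal G\}$. Each of these is $\infty$ if no such number exists. **Theorem.** Let $p\ge 3$ and $k\ge 1$ be integers, and let $\mathcal G$ be the class of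 $K_p$-free graphs of treewidth $k$. Then $\chi_\Delta(\mathcal G)$, $\chi_\star(\mathcal G)$ and $\chi(\mathcal G)$ are finite and $$\chi_\Delta(\mathcal G)=\chi_\star(\mathcal G)=\chi(\mathcal G).$$ This holds both when "of treewidth $k$" means treewidth exactly $k$ and when it means treewidth at most $k$. -/

import Mathlib

/-- A finite simple undirected graph. -/
structure FiniteGraph where
  /-- The vertex set. -/
  V : Type
  /-- The vertex set is finite. -/
  fintypeV : Fintype V
  /-- The adjacency structure. -/
  graph : SimpleGraph V

/-- A tree-decomposition of `G` indexed by the vertices of a tree `T`. -/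
structure TreeDecomposition {V : Type} (G : SimpleGraph V) {ι : Type} (T : SimpleGraph ι) where
  isTree : T.IsTree
  bag : ι → Finset V
  edge_mem : ∀ u v : V, G.Adj u v → ∃ x, u ∈ bag x ∧ v ∈ bag x
  /-- The nodes whose bags contain `v` induce a non-empty connected subtree
  (`SimpleGraph.Connected` includes non-emptiness). -/
  connected : ∀ v : V, (T.induce {x | v ∈ bag x}).Connected

/-- The width of a tree-decomposition: the maximum size of a bag, minus one.  It is an integer,
since the graph with no vertices has a tree-decomposition of width `-1`. -/
def TreeDecomposition.width {V : Type} {G : SimpleGraph V} {ι : Type} [Fintype ι]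
    {T : SimpleGraph ι} (D : TreeDecomposition G T) : ℤ :=
  ((Finset.univ.sup fun x => (D.bag x).card : ℕ) : ℤ) - 1

/-- The treewidth of a graph: the minimum width of a tree-decomposition. -/
noncomputable def treewidth (G : FiniteGraph) : ℤ :=
  sInf {w : ℤ | ∃ (ι : Type) (_ : Fintype ι) (T : SimpleGraph ι)
    (D : TreeDecomposition G.graph T), D.width = w}

/-- The type of monochromatic components of colour `i` for a colouring `f` of `G`: the connected
components of the subgraph of `G` induced by the vertices of colour `i`. -/
abbrev MonoComponent {V : Type} (G : SimpleGraph V) {c : ℕ} (f : V → Fin c) (i : Fin c) : Type :=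
  (G.induce {v | f v = i}).ConnectedComponent

/-- The colouring `f` has defect `d`: every monochromatic component has maximum degree
at most `d`. -/
def HasDefect {V : Type} (G : SimpleGraph V) {c : ℕ} (f : V → Fin c) (d : ℕ) : Prop :=
  ∀ (i : Fin c) (C : MonoComponent G f i), ∀ v, (C.toSimpleGraph.neighborSet v).ncard ≤ d

/-- The colouring `f` has clustering `m`: every monochromatic component has at most
`m` vertices. -/
def HasClustering {V : Type} (G : SimpleGraph V) {c : ℕ} (f : V → Fin c) (m : ℕ) : Prop :=
  ∀ (i : Fin c) (C : MonoComponent G f i), C.supp.ncard ≤ m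

/-- The defective chromatic number of a class of graphs; `⊤` means unbounded. -/
noncomputable def defectiveChromaticNumber (𝒢 : Set FiniteGraph) : ℕ∞ :=
  ⨅ c ∈ {c : ℕ | ∃ d : ℕ, ∀ G ∈ 𝒢, ∃ f : G.V → Fin c, HasDefect G.graph f d}, (c : ℕ∞)

/-- The clustered chromatic number of a class of graphs; `⊤` means unbounded. -/
noncomputable def clusteredChromaticNumber (𝒢 : Set FiniteGraph) : ℕ∞ :=
  ⨅ c ∈ {c : ℕ | ∃ m : ℕ, ∀ G ∈ 𝒢, ∃ f : G.V → Fin c, HasClustering G.graph f m}, (c : ℕ∞)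

/-- The (proper) chromatic number of a class of graphs: the maximum of the chromatic numbers of
its members; `⊤` means unbounded. -/
noncomputable def classChromaticNumber (𝒢 : Set FiniteGraph) : ℕ∞ :=
  ⨆ G ∈ 𝒢, G.graph.chromaticNumber

/-- The class of `K_p`-free graphs of treewidth exactly `k`. -/
def cliqueFreeTreewidthEq (p k : ℕ) : Set FiniteGraph :=
  {G | G.graph.CliqueFree p ∧ treewidth G = k}

/-- The class of `K_p`-free graphs of treewidth at most `k`. -/
def cliqueFreeTreewidthLE (p k : ℕ) : Set FiniteGraph :=
  {G | G.graph.CliqueFree p ∧ treewidth G ≤ k}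

/-! A proper colouring has clustering 1, and clustering `m` implies defect `m`, so defective ≤
clustered ≤ chromatic. Greedy colouring with `k + 1` colours gives finiteness. For the converse, fix
`G` and `d`. `exists_companion` builds `H` with the treewidth of `G` and a homomorphism to `G`,
hence in the same class, such that a colouring of `H` of defect `d` yields a proper colouring of `G`
with the same colours. A tree-decomposition orders the vertices of `G` so that each has few
predecessors, pairwise related (`EliminationScheme`). `H` is a tree of copies: along each branch the
next vertex has `|V| * d + 1` copies, attached to the same earlier copies. Each earlier neighbour
shares its colour with at most `d` of them, so some copy avoids all these colours; choosing such
copies successively gives a properly coloured copy of `G`. The scheme lifts to `H`, and `G` embeds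
in `H`, so the treewidths agree. -/

open SimpleGraph

/-! ### Subtrees of a rooted tree -/

/-- In a rooted tree a vertex has at most one neighbour closer to the root. -/
theorem SimpleGraph.IsTree.eq_of_adj_of_dist_lt {ι : Type*} {T : SimpleGraph ι} (hT : T.IsTree)
    (r : ι) {x y z : ι} (hy : T.Adj x y) (hz : T.Adj x z)
    (hyd : T.dist r y < T.dist r x) (hzd : T.dist r z < T.dist r x) : y = z := by
  obtain ⟨p, hp, -⟩ := hT.connected.exists_path_of_dist r x
  have key : ∀ w, T.Adj x w → T.dist r w < T.dist r x → w = p.penultimate := by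
    intro w hw hwd
    obtain ⟨q, hq, hql⟩ := hT.connected.exists_path_of_dist r w
    refine hT.isAcyclic.eq_penultimate_of_adj_end hp hw
      (hT.isAcyclic.mem_support_of_ne_mem_support_of_adj_of_isPath hp hq hw ?_)
    intro hx
    classical
    have h1 := T.dist_le (q.takeUntil x hx)
    have h2 := q.length_takeUntil_le_length hx
    omega
  rw [key y hy hyd, key z hz hzd]

/-- A connected set of nodes of a rooted tree contains the parent of each of its nodes
other than a topmost one. -/
theorem SimpleGraph.IsTree.exists_adj_dist_lt_of_connected {ι : Type*} {T : SimpleGraph ι}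
    (hT : T.IsTree) (r : ι) {S : Set ι} (hS : (T.induce S).Connected) {x t : ι}
    (hx : x ∈ S) (ht : t ∈ S) (hxt : x ≠ t) (hd : T.dist r t ≤ T.dist r x) :
    ∃ y ∈ S, T.Adj x y ∧ T.dist r y < T.dist r x := by
  by_contra! hno
  let R : ι → ι → Prop := fun a b => T.Adj a b ∧ T.dist r b < T.dist r a
  -- If `x` has no parent in `S`, a walk in `S` from `x` never leaves the nodes below `x`: a step
  -- away from the root extends the descent, and a step towards it undoes the last one, since
  -- parents are unique.
  have hdesc : ∀ z : S, Relation.ReflTransGen R z x := by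
    intro z
    have hreach := hS.preconnected ⟨x, hx⟩ z
    rw [reachable_iff_reflTransGen] at hreach
    induction hreach with
    | refl => exact .refl
    | @tail y z _ hyz ih =>
      have hadj : T.Adj y z := hyz
      rcases lt_or_gt_of_ne (hT.dist_ne_of_adj r hadj) with h | h
      · exact .head ⟨hadj.symm, h⟩ ih
      · rcases ih.cases_head with h' | ⟨w, hw, hwx⟩
        · rw [h'] at hadj h
          exact absurd h (not_lt.mpr (hno z z.2 hadj))
        · rwa [hT.eq_of_adj_of_dist_lt r hadj hw.1 h hw.2]
  rcases (hdesc ⟨t, ht⟩).cases_head with h | ⟨w, hw, hwx⟩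
  · exact hxt h.symm
  · have hle : T.dist r x ≤ T.dist r w := by
      clear hw
      induction hwx using Relation.ReflTransGen.head_induction_on with
      | refl => exact le_rfl
      | head h _ ih => exact ih.trans h.2.le
    have := hw.2
    simp only at this
    omega

/-- If two subtrees of a rooted tree meet, the higher one contains the top of the lower one. -/
theorem SimpleGraph.IsTree.top_mem_of_connected {ι : Type*} {T : SimpleGraph ι} (hT : T.IsTree)
    (r : ι) {S S' : Set ι} (hS : (T.induce S).Connected) (hS' : (T.induce S').Connected)
    {t t' : ι} (ht : t ∈ S) (ht' : t' ∈ S') (hmin' : ∀ y ∈ S', T.dist r t' ≤ T.dist r y)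
    (htt' : T.dist r t ≤ T.dist r t') {x : ι} (hx : x ∈ S) (hx' : x ∈ S') : t' ∈ S := by
  -- Climb from `x`: its parent is unique, so it lies in both subtrees until `t'` is reached.
  induction hn : T.dist r x using Nat.strong_induction_on generalizing x with
  | _ n ih =>
    subst hn
    by_cases h' : x = t'
    · exact h' ▸ hx
    obtain ⟨y, hyS, hxy, hyd⟩ :=
      hT.exists_adj_dist_lt_of_connected r hS' hx' ht' h' (hmin' x hx')
    have h : x ≠ t := by
      rintro rfl
      exact absurd (htt'.trans (hmin' y hyS)) (not_le.mpr hyd)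
    obtain ⟨z, hzS, hxz, hzd⟩ :=
      hT.exists_adj_dist_lt_of_connected r hS hx ht h (htt'.trans (hmin' x hx'))
    obtain rfl := hT.eq_of_adj_of_dist_lt r hxy hxz hyd hzd
    exact ih _ hyd hzS hyS rfl

/-! ### Elimination schemes and tree-decompositions -/

/-- A ranking of the vertices of `G` together with, for each vertex, a set of fewer than `w`
predecessors of lower rank: every edge joins a vertex to one of its predecessors, and any two
predecessors of a vertex are related in the same way. -/
structure EliminationScheme {V : Type} (G : SimpleGraph V) (w : ℕ) where
  rank : V → ℕ
  pred : V → Finset V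
  rank_lt : ∀ {u v}, u ∈ pred v → rank u < rank v
  card_lt : ∀ v, (pred v).card < w
  adj : ∀ {u v}, G.Adj u v → u ∈ pred v ∨ v ∈ pred u
  chordal : ∀ {u u' v}, u ∈ pred v → u' ∈ pred v → u ≠ u' → u ∈ pred u' ∨ u' ∈ pred u

/-- Order vertices by the depth of the top node of their subtree. Of two vertices sharing a bag, the
earlier lies in the top bag of the later, so predecessors can be read off from top bags. -/
theorem TreeDecomposition.exists_eliminationScheme {V : Type} [Finite V] {G : SimpleGraph V}
    {ι : Type} {T : SimpleGraph ι} (D : TreeDecomposition G T) {w : ℕ}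
    (hw : ∀ x, (D.bag x).card ≤ w) :
    ∃ E : EliminationScheme G w, Function.Injective E.rank := by
  classical
  have := Fintype.ofFinite V
  have hT := D.isTree
  obtain ⟨r⟩ := hT.connected.nonempty
  have hex : ∀ v : V, ∃ t, v ∈ D.bag t ∧ ∀ y, v ∈ D.bag y → T.dist r t ≤ T.dist r y := by
    intro v
    have hne : {x | v ∈ D.bag x}.Nonempty := by
      obtain ⟨⟨x, hx⟩⟩ := (D.connected v).nonempty
      exact ⟨x, hx⟩
    obtain ⟨t, ht, hmin⟩ := exists_minimalFor_of_wellFoundedLT _ (T.dist r) hne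
    exact ⟨t, ht, fun y hy => (le_total _ _).elim id fun h => hmin hy h⟩
  choose top htop hmin using hex
  let e := Fintype.equivFin V
  let n := Fintype.card V
  -- Lexicographic order on (depth of top, index): as `e v < n`, the index only breaks ties.
  let rank : V → ℕ := fun v => T.dist r (top v) * n + e v
  have hlt : ∀ v, (e v : ℕ) < n := fun v => (e v).2
  have hrank : ∀ {u v}, rank u < rank v → T.dist r (top u) ≤ T.dist r (top v) := by
    intro u v huv
    by_contra! hcon
    have h1 := Nat.mul_le_mul_right n (Nat.succ_le_of_lt hcon)
    have h2 := hlt v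
    simp only [rank, Nat.succ_mul] at huv h1
    omega
  have hinj : Function.Injective rank := by
    intro u v huv
    apply e.injective
    ext
    have := congrArg (· % n) huv
    simpa [rank, Nat.add_mod, Nat.mod_eq_of_lt (hlt _)] using this
  have key : ∀ {u v x}, u ∈ D.bag x → v ∈ D.bag x → rank u < rank v → u ∈ D.bag (top v) :=
    fun {u v x} hu hv huv => hT.top_mem_of_connected r (D.connected u) (D.connected v)
      (t := top u) (htop u) (htop v) (hmin v) (hrank huv) hu hv
  let pred : V → Finset V := fun v => (D.bag (top v)).filter fun u => rank u < rank v
  have hpred : ∀ {u v x}, u ∈ D.bag x → v ∈ D.bag x → u ≠ v → u ∈ pred v ∨ v ∈ pred u := by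
    intro u v x hu hv huv
    rcases lt_or_gt_of_ne (hinj.ne huv) with h | h
    · exact .inl (Finset.mem_filter.mpr ⟨key hu hv h, h⟩)
    · exact .inr (Finset.mem_filter.mpr ⟨key hv hu h, h⟩)
  refine ⟨⟨rank, pred, fun h => (Finset.mem_filter.mp h).2, fun v => ?_, fun {u v} h => ?_,
    fun hu hu' hne => hpred (Finset.mem_filter.mp hu).1 (Finset.mem_filter.mp hu').1 hne⟩, hinj⟩
  · refine lt_of_lt_of_le (Finset.card_lt_card ?_) (hw (top v))
    exact Finset.filter_ssubset.mpr ⟨v, htop v, lt_irrefl _⟩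
  · obtain ⟨x, hu, hv⟩ := D.edge_mem u v h
    exact hpred hu hv h.ne

/-- Given a map decreasing the rank of every element into a set with a root added, joining every
element to its image yields a tree. -/
theorem isTree_of_parent {V : Type} [Finite V] (rank : V → ℕ) (par : V → Option V)
    (hpar : ∀ v, ∀ u ∈ par v, rank u < rank v) :
    (SimpleGraph.fromRel fun x y : Option V => ∃ v, x = some v ∧ y = par v).IsTree := by
  set T := SimpleGraph.fromRel fun x y : Option V => ∃ v, x = some v ∧ y = par v with hTdef
  have hadj : ∀ v, T.Adj (some v) (par v) := by
    intro v
    refine (fromRel_adj _ _ _).mpr ⟨fun h => ?_, .inl ⟨v, rfl, rfl⟩⟩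
    exact lt_irrefl _ (hpar v v h.symm)
  have hroot : ∀ n v, rank v = n → T.Reachable (some v) none := by
    intro n
    induction n using Nat.strong_induction_on with
    | _ n ih =>
      intro v hv
      refine (hadj v).reachable.trans ?_
      cases h : par v with
      | none => exact .rfl
      | some u => exact ih _ (hv ▸ hpar v u h) u rfl
  have hconn : T.Connected := by
    refine (connected_iff_exists_forall_reachable _).mpr ⟨none, fun x => ?_⟩
    cases x with
    | none => exact .rfl
    | some v => exact (hroot _ v rfl).symm
  -- The pairs `{v, par v}` exhaust the edges, so there are at most `|V|` edges on `|V| + 1` nodes.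
  refine isTree_iff_connected_and_card.mpr ⟨hconn, le_antisymm ?_
    hconn.card_vert_le_card_edgeSet_add_one⟩
  rw [Finite.card_option]
  refine Nat.succ_le_succ (Nat.card_le_card_of_surjective
    (fun v => (⟨s(some v, par v), hadj v⟩ : T.edgeSet)) ?_)
  rintro ⟨e, he⟩
  induction e using Sym2.ind with
  | _ x y =>
    have hxy : T.Adj x y := he
    rcases ((fromRel_adj _ _ _).mp hxy).2 with ⟨v, rfl, rfl⟩ | ⟨v, rfl, rfl⟩
    · exact ⟨v, rfl⟩
    · exact ⟨v, Subtype.ext Sym2.eq_swap⟩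

/-- Hang each `v` below its predecessor of highest rank, or below the extra root if it has none,
with bag `{v} ∪ pred v`. -/
theorem EliminationScheme.exists_treeDecomposition {V : Type} [Finite V] {G : SimpleGraph V}
    {w : ℕ} (E : EliminationScheme G w) :
    ∃ (T : SimpleGraph (Option V)) (D : TreeDecomposition G T), ∀ x, (D.bag x).card ≤ w := by
  classical
  have hex : ∀ v, ∃ p : Option V, (∀ u ∈ p, u ∈ E.pred v) ∧
      ∀ u ∈ E.pred v, ∃ q ∈ p, E.rank u ≤ E.rank q := by
    intro v
    rcases (E.pred v).eq_empty_or_nonempty with h | h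
    · exact ⟨none, by simp [h]⟩
    · obtain ⟨q, hq, hmax⟩ := Finset.exists_max_image _ E.rank h
      exact ⟨some q, by simpa using hq, fun u hu => ⟨q, rfl, hmax u hu⟩⟩
  choose par hpar hmax using hex
  have hT := isTree_of_parent E.rank par fun v u hu => E.rank_lt (hpar v u hu)
  set T := SimpleGraph.fromRel fun x y : Option V => ∃ v, x = some v ∧ y = par v with hTdef
  let bag : Option V → Finset V := fun x => x.elim ∅ fun v => insert v (E.pred v)
  have hbag : ∀ v, v ∈ bag (some v) := fun v => Finset.mem_insert_self _ _
  have hreach : ∀ v n u, E.rank u = n → (hu : v ∈ bag (some u)) →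
      (T.induce {x | v ∈ bag x}).Reachable ⟨some v, hbag v⟩ ⟨some u, hu⟩ := by
    intro v n
    induction n using Nat.strong_induction_on with
    | _ n ih =>
      intro u hn hu
      rcases Finset.mem_insert.mp hu with rfl | hvu
      · exact .rfl
      obtain ⟨q, hq, hvq⟩ := hmax u v hvu
      have hqu := hpar u q hq
      have hvq' : v ∈ bag (some q) := by
        -- Both `v` and `q` precede `u` and `q` ranks highest, so chordality puts `v` in the bag of
        -- `q`.
        by_cases h : v = q
        · exact h ▸ hbag v
        · refine Finset.mem_insert_of_mem ((E.chordal hvu hqu h).resolve_right fun h' => ?_)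
          exact absurd (E.rank_lt h') (not_lt.mpr hvq)
      refine (ih _ (hn ▸ E.rank_lt hqu) q rfl hvq').trans (Adj.reachable ?_)
      change T.Adj (some q) (some u)
      refine (fromRel_adj _ _ _).mpr ⟨fun h => ?_, .inr ⟨u, rfl, hq.symm⟩⟩
      have := Option.some_injective _ h
      exact lt_irrefl _ (this ▸ E.rank_lt hqu)
  refine ⟨T, ⟨hT, bag, fun u v h => ?_, fun v => ?_⟩, fun x => ?_⟩
  · rcases E.adj h with h | h
    · exact ⟨some v, Finset.mem_insert_of_mem h, hbag v⟩
    · exact ⟨some u, hbag u, Finset.mem_insert_of_mem h⟩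
  · refine (connected_iff_exists_forall_reachable _).mpr ⟨⟨some v, hbag v⟩, ?_⟩
    rintro ⟨x, hx⟩
    cases x with
    | none => simp [bag] at hx
    | some u => exact hreach v _ u rfl hx
  · cases x with
    | none => simp [bag]
    | some v => exact (Finset.card_insert_le _ _).trans (E.card_lt v)

/-- Greedy colouring along an elimination scheme. -/
theorem EliminationScheme.colorable {V : Type} {G : SimpleGraph V} {w : ℕ} [Finite V]
    (E : EliminationScheme G w) : G.Colorable w := by
  classical
  have := Fintype.ofFinite V
  have hstep : ∀ m, ∃ f : V → Fin w, ∀ v, E.rank v < m → ∀ u ∈ E.pred v, f u ≠ f v := by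
    intro m
    induction m with
    | zero => exact ⟨fun v => ⟨0, (Nat.zero_le _).trans_lt (E.card_lt v)⟩, by simp⟩
    | succ m ih =>
      obtain ⟨f, hf⟩ := ih
      have hfree : ∀ v, ∃ c, c ∉ (E.pred v).image f := by
        intro v
        by_contra! h
        have h1 : ((E.pred v).image f).card = w := by
          rw [Finset.eq_univ_iff_forall.mpr h, Finset.card_univ, Fintype.card_fin]
        have h2 := Finset.card_image_le (s := E.pred v) (f := f)
        have := E.card_lt v
        omega
      choose g hg using hfree
      refine ⟨fun v => if E.rank v < m then f v else g v, fun v hv u hu => ?_⟩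
      have hlt := E.rank_lt hu
      simp only [show E.rank u < m by omega, if_true]
      split_ifs with h
      · exact hf v h u hu
      · exact fun heq => hg v (heq ▸ Finset.mem_image_of_mem f hu)
  obtain ⟨f, hf⟩ := hstep (Finset.univ.sup E.rank + 1)
  have hf' : ∀ v, ∀ u ∈ E.pred v, f u ≠ f v := fun v =>
    hf v (Nat.lt_succ_of_le (Finset.le_sup (Finset.mem_univ v)))
  refine ⟨Coloring.mk f fun {u v} h => ?_⟩
  rcases E.adj h with h | h
  · exact hf' v u h
  · exact (hf' u v h).symm

/-! ### Treewidth through bag sizes -/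

/-- Restricting the bags of a tree-decomposition along an injective homomorphism. -/
theorem TreeDecomposition.exists_comap {V V' : Type} {G : SimpleGraph V} {G' : SimpleGraph V'}
    {ι : Type} {T : SimpleGraph ι} (D : TreeDecomposition G' T) (f : G →g G')
    (hf : Function.Injective f) :
    ∃ D' : TreeDecomposition G T, ∀ x, (D'.bag x).card ≤ (D.bag x).card := by
  classical
  refine ⟨⟨D.isTree, fun x => (D.bag x).preimage f hf.injOn, fun u v h => ?_, fun v => ?_⟩,
    fun x => ?_⟩
  · simpa using D.edge_mem _ _ (f.map_adj h)
  · have hset : {x | v ∈ (D.bag x).preimage f hf.injOn} = {x | f v ∈ D.bag x} := by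
      ext x
      simp
    rw [hset]
    exact D.connected (f v)
  · rw [← Finset.card_image_of_injective _ hf]
    exact Finset.card_le_card (Finset.image_subset_iff.mpr fun u hu => by simpa using hu)

theorem TreeDecomposition.width_le_iff {V : Type} {G : SimpleGraph V} {ι : Type} [Fintype ι]
    {T : SimpleGraph ι} (D : TreeDecomposition G T) {w : ℕ} :
    D.width ≤ (w : ℤ) - 1 ↔ ∀ x, (D.bag x).card ≤ w := by
  simp [TreeDecomposition.width, Finset.sup_le_iff]

theorem bddBelow_widths {V : Type} (G : SimpleGraph V) :
    BddBelow {w : ℤ | ∃ (ι : Type) (_ : Fintype ι) (T : SimpleGraph ι)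
      (D : TreeDecomposition G T), D.width = w} := by
  refine ⟨-1, ?_⟩
  rintro _ ⟨ι, _, T, D, rfl⟩
  simp only [TreeDecomposition.width]
  omega

theorem exists_treeDecomposition_width_eq (G : FiniteGraph) :
    ∃ (ι : Type) (_ : Fintype ι) (T : SimpleGraph ι) (D : TreeDecomposition G.graph T),
      D.width = treewidth G := by
  have := G.fintypeV
  refine Int.csInf_mem ?_ (bddBelow_widths G.graph)
  let D : TreeDecomposition G.graph (⊥ : SimpleGraph Unit) :=
    { isTree := IsTree.of_subsingleton
      bag := fun _ => Finset.univ
      edge_mem := fun _ _ _ => ⟨(), by simp⟩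
      connected := fun v => by
        have : Nonempty {x : Unit | v ∈ (Finset.univ : Finset G.V)} := ⟨⟨(), by simp⟩⟩
        exact IsTree.of_subsingleton.connected }
  exact ⟨_, Unit, inferInstance, ⊥, D, rfl⟩

theorem treewidth_le_iff (G : FiniteGraph) (w : ℕ) :
    treewidth G ≤ (w : ℤ) - 1 ↔
      ∃ (ι : Type) (_ : Finite ι) (T : SimpleGraph ι) (D : TreeDecomposition G.graph T),
        ∀ x, (D.bag x).card ≤ w := by
  constructor
  · intro h
    obtain ⟨ι, _, T, D, hD⟩ := exists_treeDecomposition_width_eq G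
    exact ⟨ι, inferInstance, T, D, D.width_le_iff.mp (hD ▸ h)⟩
  · rintro ⟨ι, _, T, D, hD⟩
    have := Fintype.ofFinite ι
    exact (csInf_le (bddBelow_widths G.graph) ⟨ι, inferInstance, T, D, rfl⟩).trans
      (D.width_le_iff.mpr hD)

theorem exists_treewidth_eq (G : FiniteGraph) : ∃ w : ℕ, treewidth G = (w : ℤ) - 1 := by
  obtain ⟨ι, _, T, D, hD⟩ := exists_treeDecomposition_width_eq G
  exact ⟨_, hD.symm⟩

theorem treewidth_le_treewidth {G H : FiniteGraph} (f : G.graph →g H.graph)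
    (hf : Function.Injective f) : treewidth G ≤ treewidth H := by
  obtain ⟨w, hw⟩ := exists_treewidth_eq H
  obtain ⟨ι, hι, T, D, hD⟩ := (treewidth_le_iff H w).mp hw.le
  obtain ⟨D', hD'⟩ := D.exists_comap f hf
  exact hw ▸ (treewidth_le_iff G w).mpr ⟨ι, hι, T, D', fun x => (hD' x).trans (hD x)⟩

theorem exists_eliminationScheme_of_treewidth_le {G : FiniteGraph} {w : ℕ}
    (h : treewidth G ≤ (w : ℤ) - 1) :
    ∃ E : EliminationScheme G.graph w, Function.Injective E.rank := by
  have := G.fintypeV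
  obtain ⟨ι, _, T, D, hD⟩ := (treewidth_le_iff G w).mp h
  exact D.exists_eliminationScheme hD

theorem EliminationScheme.treewidth_le {G : FiniteGraph} {w : ℕ}
    (E : EliminationScheme G.graph w) : treewidth G ≤ (w : ℤ) - 1 := by
  have := G.fintypeV
  obtain ⟨T, D, hD⟩ := E.exists_treeDecomposition
  exact (treewidth_le_iff G w).mpr ⟨_, inferInstance, T, D, hD⟩

/-! ### The tree-like blow-up -/

namespace EliminationScheme

variable {V : Type} {G : SimpleGraph V} {w : ℕ}

/-- Forget the entries of a sequence at the vertices of rank above that of `v`. -/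
def truncate (E : EliminationScheme G w) {N : ℕ} (v : V) (a : V → Fin (N + 1)) :
    V → Fin (N + 1) :=
  fun u => if E.rank u ≤ E.rank v then a u else 0

theorem truncate_truncate (E : EliminationScheme G w) {N : ℕ} {u v : V}
    (h : E.rank u ≤ E.rank v) (a : V → Fin (N + 1)) :
    E.truncate u (E.truncate v a) = E.truncate u a := by
  funext x
  simp only [truncate]
  split_ifs <;> first | rfl | omega

/-- The vertices of the blow-up: copies `(v, a)` of `v`, where `a` is a sequence of elements of
`Fin (N + 1)` indexed by the vertices up to `v`. -/
abbrev BlowupVertex (E : EliminationScheme G w) (N : ℕ) : Type :=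
  {x : V × (V → Fin (N + 1)) // E.truncate x.1 x.2 = x.2}

/-- The copy of `v` at the initial segment of `a` up to `v`. -/
def copy (E : EliminationScheme G w) {N : ℕ} (v : V) (a : V → Fin (N + 1)) : E.BlowupVertex N :=
  ⟨(v, E.truncate v a), E.truncate_truncate le_rfl a⟩

theorem copy_truncate (E : EliminationScheme G w) {N : ℕ} {u v : V}
    (h : E.rank u ≤ E.rank v) (a : V → Fin (N + 1)) :
    E.copy u (E.truncate v a) = E.copy u a :=
  Subtype.ext (Prod.ext rfl (E.truncate_truncate h a))

open Classical in
/-- The copies of the predecessors of `v` on the branch of the blow-up leading to a copy of `v`. -/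
noncomputable def blowupPred (E : EliminationScheme G w) {N : ℕ} (x : E.BlowupVertex N) :
    Finset (E.BlowupVertex N) :=
  (E.pred x.1.1).image fun u => E.copy u x.1.2

theorem mem_blowupPred (E : EliminationScheme G w) {N : ℕ} {x y : E.BlowupVertex N} :
    x ∈ E.blowupPred y ↔ ∃ u ∈ E.pred y.1.1, E.copy u y.1.2 = x := by
  classical
  exact Finset.mem_image

theorem copy_mem_blowupPred (E : EliminationScheme G w) {N : ℕ} {u v : V} (h : u ∈ E.pred v)
    (a : V → Fin (N + 1)) : E.copy u a ∈ E.blowupPred (E.copy v a) :=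
  E.mem_blowupPred.mpr ⟨u, h, E.copy_truncate (E.rank_lt h).le a⟩

/-- The tree-like blow-up of `G`, in which every copy of the vertices preceding `v` extends to
`N + 1` copies of `v`. -/
def blowup (E : EliminationScheme G w) (N : ℕ) : SimpleGraph (E.BlowupVertex N) where
  -- Predecessors need not be adjacent in `G`; requiring adjacency there makes the projection a
  -- homomorphism.
  Adj x y := G.Adj x.1.1 y.1.1 ∧ (x ∈ E.blowupPred y ∨ y ∈ E.blowupPred x)
  symm := ⟨fun _ _ h => ⟨h.1.symm, h.2.symm⟩⟩
  loopless := ⟨fun _ h => h.1.ne rfl⟩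

/-- The projection of the blow-up. -/
def blowupHom (E : EliminationScheme G w) (N : ℕ) : E.blowup N →g G where
  toFun x := x.1.1
  map_rel' h := h.1

theorem blowup_adj_copy (E : EliminationScheme G w) {N : ℕ} {u v : V} (h : G.Adj u v)
    (a : V → Fin (N + 1)) : (E.blowup N).Adj (E.copy u a) (E.copy v a) :=
  ⟨h, (E.adj h).imp (fun h => E.copy_mem_blowupPred h a) fun h => E.copy_mem_blowupPred h a⟩

/-- The embedding of `G` in its blow-up along a branch. -/
def branchHom (E : EliminationScheme G w) {N : ℕ} (a : V → Fin (N + 1)) : G →g E.blowup N where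
  toFun v := E.copy v a
  map_rel' h := E.blowup_adj_copy h a

theorem branchHom_injective (E : EliminationScheme G w) {N : ℕ} (a : V → Fin (N + 1)) :
    Function.Injective (E.branchHom a) :=
  fun _ _ h => congrArg (fun x => x.1.1) h

/-- An elimination scheme lifts to the blow-up. -/
noncomputable def blowupScheme (E : EliminationScheme G w) (N : ℕ) :
    EliminationScheme (E.blowup N) w where
  rank x := E.rank x.1.1
  pred := E.blowupPred
  rank_lt h := by
    obtain ⟨u, hu, rfl⟩ := E.mem_blowupPred.mp h
    exact E.rank_lt hu
  card_lt x := by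
    classical
    exact Finset.card_image_le.trans_lt (E.card_lt x.1.1)
  adj h := h.2
  chordal := by
    intro x x' y hx hx' hne
    obtain ⟨u, hu, rfl⟩ := E.mem_blowupPred.mp hx
    obtain ⟨u', hu', rfl⟩ := E.mem_blowupPred.mp hx'
    have huu' : u ≠ u' := fun h => hne (h ▸ rfl)
    exact (E.chordal hu hu' huu').imp (fun h => E.copy_mem_blowupPred h _)
      fun h => E.copy_mem_blowupPred h _

end EliminationScheme

/-! ### From bounded defect to proper colourings -/

/-- In a colouring of defect `d` every vertex has at most `d` neighbours of its own colour. -/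
theorem HasDefect.ncard_le {V : Type} [Finite V] {G : SimpleGraph V} {c : ℕ} {f : V → Fin c}
    {d : ℕ} (h : HasDefect G f d) (v : V) : {u | G.Adj v u ∧ f u = f v}.ncard ≤ d := by
  let H := G.induce {u | f u = f v}
  let C := H.connectedComponentMk ⟨v, rfl⟩
  let v' : C := ⟨⟨v, rfl⟩, rfl⟩
  refine le_trans ?_ (h (f v) C v')
  have hsub : {u | G.Adj v u ∧ f u = f v} ⊆
      (fun x : C => (x.1.1 : V)) '' C.toSimpleGraph.neighborSet v' := by
    rintro u ⟨hadj, hu⟩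
    have hH : H.Adj ⟨v, rfl⟩ ⟨u, hu⟩ := hadj
    exact ⟨⟨⟨u, hu⟩, ConnectedComponent.sound hH.symm.reachable⟩, hH, rfl⟩
  exact (Set.ncard_le_ncard hsub (Set.toFinite _)).trans (Set.ncard_image_le (Set.toFinite _))

theorem HasClustering.hasDefect {V : Type} [Finite V] {G : SimpleGraph V} {c : ℕ} {f : V → Fin c}
    {m : ℕ} (h : HasClustering G f m) : HasDefect G f m := by
  intro i C v
  refine le_trans ?_ (h i C)
  rw [← Set.ncard_image_of_injective _ Subtype.val_injective]
  exact Set.ncard_le_ncard (by rintro _ ⟨x, -, rfl⟩; exact x.2) (Set.toFinite _)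

theorem hasClustering_one_of_proper {V : Type} {G : SimpleGraph V} {c : ℕ} {f : V → Fin c}
    (h : ∀ u v, G.Adj u v → f u ≠ f v) : HasClustering G f 1 := by
  intro i C
  have hbot : G.induce {v | f v = i} = ⊥ := by
    ext u v
    simp only [bot_adj, iff_false]
    exact fun huv => h u v huv (u.2.trans v.2.symm)
  have hsub : C.supp.Subsingleton := by
    intro x hx y hy
    have hxy : (G.induce {v | f v = i}).Reachable x y := C.reachable_of_mem_supp hx hy
    rw [hbot] at hxy
    exact reachable_bot.mp hxy
  rcases hsub.eq_empty_or_singleton with h | ⟨x, h⟩ <;> simp [h]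

/-- A colouring of bounded defect of a large blow-up is proper along some branch. -/
theorem EliminationScheme.colorable_of_hasDefect_blowup {V : Type} [Fintype V]
    {G : SimpleGraph V} {w : ℕ} (E : EliminationScheme G w) (hE : Function.Injective E.rank)
    {c d : ℕ} {f : E.BlowupVertex (Fintype.card V * d) → Fin c}
    (hf : HasDefect (E.blowup (Fintype.card V * d)) f d) : G.Colorable c := by
  classical
  -- The branch is fixed one rank at a time; injectivity of the rank leaves a single new vertex per
  -- stage.
  have hstep : ∀ m, ∃ a : V → Fin (Fintype.card V * d + 1), ∀ u v, G.Adj u v →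
      E.rank u < E.rank v → E.rank v < m → f (E.copy u a) ≠ f (E.copy v a) := by
    intro m
    induction m with
    | zero => exact ⟨0, by simp⟩
    | succ m ih =>
      obtain ⟨a, ha⟩ := ih
      by_cases hm : ∃ v, E.rank v = m
      swap
      · exact ⟨a, fun u v h huv hv => ha u v h huv
          (lt_of_le_of_ne (Nat.le_of_lt_succ hv) fun h' => hm ⟨v, h'⟩)⟩
      obtain ⟨v, hv⟩ := hm
      have hcopy : ∀ t u, E.rank u < E.rank v →
          E.copy u (Function.update a v t) = E.copy u a := by
        intro t u hu
        refine Subtype.ext (Prod.ext rfl (funext fun x => ?_))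
        simp only [EliminationScheme.copy, EliminationScheme.truncate]
        split_ifs with hx
        · exact Function.update_of_ne (by rintro rfl; omega) _ _
        · rfl
      have hcinj : Function.Injective fun t => E.copy v (Function.update a v t) := by
        intro t t' h
        have := congrFun (congrArg (fun x => x.1.2) h) v
        simpa [EliminationScheme.copy, EliminationScheme.truncate] using this
      -- Choices of copy of `v` clashing with the earlier neighbour `u`: at most `d` for each `u`,
      -- so `|V| * d + 1` choices suffice.
      let bad : V → Finset (Fin (Fintype.card V * d + 1)) := fun u =>
        Finset.univ.filter fun t => G.Adj u v ∧ E.rank u < E.rank v ∧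
          f (E.copy u a) = f (E.copy v (Function.update a v t))
      have hbad : ∀ u, (bad u).card ≤ d := by
        intro u
        refine le_trans ?_ (hf.ncard_le (E.copy u a))
        rw [← Finset.card_image_of_injective _ hcinj, ← Set.ncard_coe_finset]
        refine Set.ncard_le_ncard ?_ (Set.toFinite _)
        intro x hx
        obtain ⟨t, ht, rfl⟩ := Finset.mem_image.mp (Finset.mem_coe.mp hx)
        obtain ⟨hadj, hlt, heq⟩ := (Finset.mem_filter.mp ht).2
        refine ⟨?_, heq.symm⟩
        rw [← hcopy t u hlt]
        exact E.blowup_adj_copy hadj _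
      obtain ⟨t, ht⟩ : ∃ t, t ∉ Finset.univ.biUnion bad := by
        by_contra! h
        have h1 : (Finset.univ.biUnion bad).card = Fintype.card V * d + 1 := by
          rw [Finset.eq_univ_iff_forall.mpr h, Finset.card_univ, Fintype.card_fin]
        have h2 := Finset.card_biUnion_le_card_mul Finset.univ bad d fun u _ => hbad u
        rw [Finset.card_univ] at h2
        omega
      refine ⟨Function.update a v t, fun u v' h huv hlt => ?_⟩
      rcases (Nat.le_of_lt_succ hlt).lt_or_eq with hlt | heq
      · rw [hcopy t u (by omega), hcopy t v' (by omega)]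
        exact ha u v' h huv hlt
      · obtain rfl : v' = v := hE (heq.trans hv.symm)
        rw [hcopy t u huv]
        intro heq
        exact ht (Finset.mem_biUnion.mpr ⟨u, Finset.mem_univ _,
          Finset.mem_filter.mpr ⟨Finset.mem_univ _, h, huv, heq⟩⟩)
  obtain ⟨a, ha⟩ := hstep (Finset.univ.sup E.rank + 1)
  have hlt : ∀ v, E.rank v < Finset.univ.sup E.rank + 1 := fun v =>
    Nat.lt_succ_of_le (Finset.le_sup (Finset.mem_univ v))
  refine ⟨Coloring.mk (fun v => f (E.copy v a)) fun {u v} h => ?_⟩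
  rcases lt_or_gt_of_ne (hE.ne h.ne) with h' | h'
  · exact ha u v h h' (hlt v)
  · exact (ha v u h.symm h' (hlt u)).symm

/-- Homomorphisms out of a complete graph are injective, so cliques map to cliques of the same size.
-/
theorem SimpleGraph.CliqueFree.of_hom {V V' : Type*} {G : SimpleGraph V} {G' : SimpleGraph V'}
    {n : ℕ} (f : G' →g G) (h : G.CliqueFree n) : G'.CliqueFree n := by
  contrapose! h
  rw [not_cliqueFree_iff_top_isContained] at h ⊢
  obtain ⟨g⟩ := h
  exact ⟨⟨f.comp g.toHom, Hom.injective_of_top_hom _⟩⟩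

/-! ### Companion graphs and the equalities -/

/-- For every `d`, a graph `G` has a companion with the same treewidth and mapping to `G`, for
which colourability with defect `d` forces proper colourability of `G`. -/
theorem exists_companion (G : FiniteGraph) (d : ℕ) :
    ∃ H : FiniteGraph, treewidth H = treewidth G ∧ Nonempty (H.graph →g G.graph) ∧
      ∀ (c : ℕ) (f : H.V → Fin c), HasDefect H.graph f d → G.graph.Colorable c := by
  classical
  have := G.fintypeV
  obtain ⟨w, hw⟩ := exists_treewidth_eq G
  obtain ⟨E, hE⟩ := exists_eliminationScheme_of_treewidth_le hw.le
  let H : FiniteGraph :=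
    ⟨E.BlowupVertex (Fintype.card G.V * d), Fintype.ofFinite _, E.blowup _⟩
  refine ⟨H, le_antisymm ?_ ?_, ⟨E.blowupHom _⟩,
    fun c f hf => E.colorable_of_hasDefect_blowup hE hf⟩
  · rw [hw]
    exact (E.blowupScheme _).treewidth_le (G := H)
  · exact treewidth_le_treewidth (H := H) (E.branchHom 0) (E.branchHom_injective 0)

theorem colorable_of_treewidth_le {G : FiniteGraph} {k : ℕ} (h : treewidth G ≤ k) :
    G.graph.Colorable (k + 1) := by
  have := G.fintypeV
  obtain ⟨E, -⟩ := exists_eliminationScheme_of_treewidth_le (G := G) (w := k + 1)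
    (by push_cast; omega)
  exact E.colorable

/-- The three chromatic numbers agree, and are finite, for a class of graphs of treewidth at most
`k` that contains every graph of the same treewidth as some member to which it maps. -/
theorem chromaticNumbers_eq_of_closed {𝒢 : Set FiniteGraph} {k : ℕ}
    (hk : ∀ G ∈ 𝒢, treewidth G ≤ k)
    (hclosed : ∀ G ∈ 𝒢, ∀ H : FiniteGraph, treewidth H = treewidth G →
      Nonempty (H.graph →g G.graph) → H ∈ 𝒢) :
    defectiveChromaticNumber 𝒢 = clusteredChromaticNumber 𝒢 ∧
      clusteredChromaticNumber 𝒢 = classChromaticNumber 𝒢 ∧ classChromaticNumber 𝒢 ≠ ⊤ := by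
  have hfin : classChromaticNumber 𝒢 ≠ ⊤ := by
    refine ne_top_of_le_ne_top (ENat.natCast_ne_top (k + 1)) (iSup₂_le fun G hG => ?_)
    exact chromaticNumber_le_iff_colorable.mpr (colorable_of_treewidth_le (hk G hG))
  have h1 : defectiveChromaticNumber 𝒢 ≤ clusteredChromaticNumber 𝒢 := by
    refine le_iInf₂ fun c hc => iInf₂_le c ?_
    obtain ⟨m, hm⟩ := hc
    refine ⟨m, fun G hG => ?_⟩
    have := G.fintypeV
    obtain ⟨f, hf⟩ := hm G hG
    exact ⟨f, hf.hasDefect⟩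
  have h2 : clusteredChromaticNumber 𝒢 ≤ classChromaticNumber 𝒢 := by
    obtain ⟨c, hc⟩ := ENat.ne_top_iff_exists.mp hfin
    rw [← hc]
    refine iInf₂_le c ⟨1, fun G hG => ?_⟩
    have hle : G.graph.chromaticNumber ≤ c :=
      hc ▸ le_iSup₂ (f := fun (G : FiniteGraph) (_ : G ∈ 𝒢) => G.graph.chromaticNumber) G hG
    obtain ⟨f⟩ := chromaticNumber_le_iff_colorable.mp hle
    exact ⟨f, hasClustering_one_of_proper fun u v h => f.valid h⟩
  have h3 : classChromaticNumber 𝒢 ≤ defectiveChromaticNumber 𝒢 := by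
    refine le_iInf₂ fun c hc => iSup₂_le fun G hG => ?_
    obtain ⟨d, hd⟩ := hc
    obtain ⟨H, htw, hhom, hcol⟩ := exists_companion G d
    obtain ⟨f, hf⟩ := hd H (hclosed G hG H htw hhom)
    exact chromaticNumber_le_iff_colorable.mpr (hcol c f hf)
  exact ⟨le_antisymm h1 (h2.trans h3), le_antisymm h2 (h3.trans h1), hfin⟩

theorem mainTheorem1 (p k : ℕ) (hp : 3 ≤ p) (hk : 1 ≤ k) :
    (defectiveChromaticNumber (cliqueFreeTreewidthEq p k) =
        clusteredChromaticNumber (cliqueFreeTreewidthEq p k) ∧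
      clusteredChromaticNumber (cliqueFreeTreewidthEq p k) =
        classChromaticNumber (cliqueFreeTreewidthEq p k) ∧
      classChromaticNumber (cliqueFreeTreewidthEq p k) ≠ ⊤) ∧
    (defectiveChromaticNumber (cliqueFreeTreewidthLE p k) =
        clusteredChromaticNumber (cliqueFreeTreewidthLE p k) ∧
      clusteredChromaticNumber (cliqueFreeTreewidthLE p k) =
        classChromaticNumber (cliqueFreeTreewidthLE p k) ∧
      classChromaticNumber (cliqueFreeTreewidthLE p k) ≠ ⊤) := by
  exact ⟨chromaticNumbers_eq_of_closed (fun G hG => hG.2.le)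
      fun G hG H htw ⟨f⟩ => ⟨hG.1.of_hom f, htw.trans hG.2⟩,
    chromaticNumbers_eq_of_closed (fun G hG => hG.2)
      fun G hG H htw ⟨f⟩ => ⟨hG.1.of_hom f, htw.le.trans hG.2⟩⟩
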